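/- Let $X=[a,b]\subset\mathbb R$ be a compact interval and let $Z=Z_-\cup Z_+$, where $Z_-=[\underline{z_-},\overline{z_-}]$ and $Z_+=[\underline{z_+},\overline{z_+}]$ are compact intervals. Let $\sigma_X$ and $\sigma_Z$ be Borel probability measures on $X$ and $Z$, respectively, let $y=\int_Z z\,d\sigma_Z(z)$, and assume that $\overline{z_-}<y<\underline{z_+}$ and that $\sigma_X$ has no atoms. Let $c:X\times Z\to\mathbb R$ be continuous and satisfy the martingale Spence–Mirrlees condition: for all $x<x'$ in $X$ the function $z\mapsto c(x',z)-c(x,z)$ is strictly concave on $Z$, in the sense that the strict concavity inequality holds whenever the three points of $\mathbb R$ in it belong to $Z$. Let $\Pi^{y}(\sigma_X,\sigma_Z)$ be the set of all probability measures $\pi=\sigma_X\otimes\kappa$ on $X\times Z$ with marginals $\sigma_X$ and $\sigma_Z$ whose conditional probabilities satisfy $\int z\,\kappa(x,dz)=y$ for $\sigma_X$-almost every $x$. Then the fixed-barycenter problem $$\min_{\pi\in\Pi^{y}(\sigma_X,\sigma_Z)}\int_{X\times Z} c(x,z)\,d\pi(x,z)$$ has exactly one solution $\pi$. Moreover, there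 are a non-increasing map $T_-:X\to Z_-$ and a non-decreasing map $T_+:X\to Z_+$ such that $\pi$ is concentrated on the union of the graphs of $T_-$ and $T_+$; more precisely, the conditional probability of $z$ given $x$ under $\pi=\sigma_X\otimes\kappa$ is $$\kappa(x,dz)=\alpha_-(x)\,\delta_{T_-(x)}(dz)+\alpha_+(x)\,\delta_{T_+(x)}(dz)\quad\text{for }\sigma_X\text{-almost every }x,$$ with $\alpha_\pm(x)>0$ and $\alpha_-(x)+\alpha_+(x)=1$. -/

import Mathlib

open MeasureTheory ProbabilityTheory Set
open scoped NNReal ENNReal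

namespace FixedBarycenter

/-- The couplings `Π(σX, σZ)`: measures on the plane with marginals `σX` and `σZ`. -/
def Couplings (σX σZ : Measure ℝ) : Set (Measure (ℝ × ℝ)) :=
  {π | π.fst = σX ∧ π.snd = σZ}

/-- `κ` is a conditional probability of the second variable given the first one:
`π = σX ⊗ κ`. -/
structure IsDisintegration (π : Measure (ℝ × ℝ)) (σX : Measure ℝ) (κ : Kernel ℝ ℝ) : Prop where
  isMarkov : IsMarkovKernel κ
  eq_compProd : π = σX ⊗ₘ κ

/-- The couplings `π = σX ⊗ κ` of `σX` and `σZ` such that the conditional probability `κ x`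
has barycenter `F x`, for `σX`-almost every `x`. -/
def BarCouplings (F : ℝ → ℝ) (σX σZ : Measure ℝ) : Set (Measure (ℝ × ℝ)) :=
  {π | π ∈ Couplings σX σZ ∧ ∃ κ : Kernel ℝ ℝ, IsDisintegration π σX κ ∧
    ∀ᵐ x ∂σX, Integrable (fun z : ℝ => z) (κ x) ∧ ∫ z, z ∂(κ x) = F x}

/-- `π` solves the fixed-barycenter problem: it minimizes `∫ c dπ` over the couplings of `σX` and
`σZ` all of whose conditional probabilities have the mean of `σZ` as barycenter. (The notion is
used for `c` continuous on a compact set that carries all couplings, so all these integrals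
converge.) -/
def IsSolution (c : ℝ → ℝ → ℝ) (σX σZ : Measure ℝ) (π : Measure (ℝ × ℝ)) : Prop :=
  π ∈ BarCouplings (fun _ => ∫ z, z ∂σZ) σX σZ ∧
    ∀ π' ∈ BarCouplings (fun _ => ∫ z, z ∂σZ) σX σZ,
      ∫ p, c p.1 p.2 ∂π ≤ ∫ p, c p.1 p.2 ∂π'

/-- Strict concavity of a function on a set that need not be convex: the strict concavity
inequality holds whenever all three points that occur in it belong to the set. On a convex set
this is the usual strict concavity. -/
def StrictConcaveOnPoints (Z : Set ℝ) (f : ℝ → ℝ) : Prop :=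
  ∀ ⦃u : ℝ⦄, u ∈ Z → ∀ ⦃v : ℝ⦄, v ∈ Z → u ≠ v →
    ∀ ⦃s t : ℝ⦄, 0 < s → 0 < t → s + t = 1 → s * u + t * v ∈ Z →
      s * f u + t * f v < f (s * u + t * v)

/-- The martingale Spence–Mirrlees condition on `X × Z`: for all `x < x'` in `X` the function
`z ↦ c x' z - c x z` is strictly concave on `Z`. -/
def MartingaleSpenceMirrlees (X Z : Set ℝ) (c : ℝ → ℝ → ℝ) : Prop :=
  ∀ ⦃x : ℝ⦄, x ∈ X → ∀ ⦃x' : ℝ⦄, x' ∈ X → x < x' →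
    StrictConcaveOnPoints Z (fun z => c x' z - c x z)

end FixedBarycenter

/-! Existence is the direct method. The work lies in an exchange argument. Suppose x < x' and u < w
< v with w = s u + (1 - s) v. Mass at (x, u) and (x, v), in proportions s and 1 - s, can be traded
for equal mass at (x', w) without changing marginals or barycenters. With g = c(x', ·) - c(x, ·),
the cost changes by s g(u) + (1 - s) g(v) - g(w) < 0. Hence a minimizer gives no mass to such
configurations (`ae_not_swap`).

The barycenter y lies in the gap, so almost every conditional charges both intervals. A charged
point of one interval is a ready-made outer point for a swap in the other. Forbidding swaps
therefore orders the upper points increasingly and the lower points decreasingly in x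
(`exists_monotone_graphs`). Such an order leaves room for several values only at countably many x,
which an atomless σX ignores (`exists_monotone_ae_eq`).

A probability on two points is determined by its mean, so the two graphs determine the conditionals.
The average of two minimizers is a minimizer; its graphs carry both of them, which forces them to
coincide. -/

namespace FixedBarycenter

open Filter Topology BoundedContinuousFunction

/-! ### Monotone maps from almost sure pairwise order -/

/-- If `Y` is almost surely ordered like `X` along pairs of points, and `X` has no atoms, then `Y`
is almost surely a monotone function of `X`. -/
lemma exists_monotone_ae_eq {Ω : Type*} [MeasurableSpace Ω] {ρ : Measure Ω} {X Y : Ω → ℝ}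
    (hna : ∀ x, ρ (X ⁻¹' {x}) = 0) {l h : ℝ} (hlh : l ≤ h) (hb : ∀ᵐ p ∂ρ, Y p ∈ Icc l h)
    (hm : ∀ᵐ q ∂ρ, ∀ᵐ p ∂ρ, X p < X q → Y p ≤ Y q) :
    ∃ T : ℝ → ℝ, Monotone T ∧ (∀ x, T x ∈ Icc l h) ∧ ∀ᵐ p ∂ρ, Y p = T (X p) := by
  set S : ℝ → Set ℝ := fun x => {t | t ∈ Icc l h ∧ ∀ᵐ p ∂ρ, X p < x → Y p ≤ t} with hS
  have hS_mem : ∀ x, h ∈ S x := fun x =>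
    ⟨⟨hlh, le_rfl⟩, hb.mono fun p hp _ => hp.2⟩
  have hS_bdd : ∀ x, BddBelow (S x) := fun x => ⟨l, fun t ht => ht.1.1⟩
  -- This is the essential supremum of `Y` over `X < x`, kept inside `[l, h]`.
  set T : ℝ → ℝ := fun x => sInf (S x) with hT
  have hmono : Monotone T := fun x x' hxx' =>
    csInf_le_csInf (hS_bdd x) ⟨h, hS_mem x'⟩ fun t ht =>
      ⟨ht.1, ht.2.mono fun p hp hpx => hp (hpx.trans_le hxx')⟩
  have hTle : ∀ x, ∀ᵐ p ∂ρ, X p < x → Y p ≤ T x := by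
    intro x
    have : ∀ n : ℕ, ∀ᵐ p ∂ρ, X p < x → Y p ≤ T x + 1 / ((n : ℝ) + 1) := by
      intro n
      obtain ⟨t, ht, htx⟩ := exists_lt_of_csInf_lt ⟨h, hS_mem x⟩
        (show sInf (S x) < T x + 1 / ((n : ℝ) + 1) from lt_add_of_pos_right _ (by positivity))
      exact ht.2.mono fun p hp hpx => (hp hpx).trans htx.le
    filter_upwards [ae_all_iff.2 this] with p hp hpx
    refine ge_of_tendsto' (x := atTop) (f := fun n : ℕ => T x + 1 / ((n : ℝ) + 1)) ?_ fun n => hp n hpx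
    simpa using tendsto_one_div_add_atTop_nhds_zero_nat.const_add (T x)
  have hdisc : ∀ᵐ p ∂ρ, ContinuousAt T (X p) := by
    have hnull : ρ (X ⁻¹' {x | ¬ ContinuousAt T x}) = 0 := by
      rw [← biUnion_of_singleton {x | ¬ ContinuousAt T x}, preimage_iUnion₂,
        measure_biUnion_null_iff hmono.countable_not_continuousAt]
      exact fun x _ => hna x
    exact hnull
  refine ⟨T, hmono, fun x => ⟨le_csInf ⟨h, hS_mem x⟩ fun t ht => ht.1.1,
    csInf_le (hS_bdd x) (hS_mem x)⟩, ?_⟩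
  -- The order makes `Y p` an essential upper bound on `X < X p`, so `T (X p) ≤ Y p`. Conversely `Y
  -- p ≤ T r` for every rational `r > X p`, and continuity of `T` at `X p` closes the gap.
  filter_upwards [hb, hm, hdisc, ae_all_iff.2 fun r : ℚ => hTle r] with p hpb hpm hpc hpr
  refine le_antisymm ?_ (csInf_le (hS_bdd _) ⟨hpb, hpm⟩)
  refine ge_of_tendsto (hpc.tendsto.mono_left (nhdsWithin_le_nhds (s := Ioi (X p)))) ?_
  filter_upwards [self_mem_nhdsWithin] with x hx
  obtain ⟨r, hr1, hr2⟩ := exists_rat_btwn (mem_Ioi.1 hx)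
  exact (hpr r hr1).trans (hmono hr2.le)

/-! ### Swaps that keep marginals and barycenters -/

/-- The weight of `u` in the representation of `w` as a convex combination of `u` and `v`. -/
noncomputable def weight (u v w : ℝ) : ℝ := (v - w) / (v - u)

lemma weight_nonneg {u v w : ℝ} (h1 : u < w) (h2 : w < v) : 0 ≤ weight u v w :=
  div_nonneg (by linarith) (by linarith)

lemma weight_pos {u v w : ℝ} (h1 : u < w) (h2 : w < v) : 0 < weight u v w :=
  div_pos (by linarith) (by linarith)

lemma weight_lt_one {u v w : ℝ} (h1 : u < w) (h2 : w < v) : weight u v w < 1 :=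
  (div_lt_one (by linarith)).2 (by linarith)

lemma weight_combination {u v w : ℝ} (h1 : u < w) (h2 : w < v) :
    weight u v w * u + (1 - weight u v w) * v = w := by
  have : v - u ≠ 0 := by linarith
  unfold weight
  field_simp
  ring

/-- The change of `∫ h` when mass at `(x, u)`, `(x, v)`, `(x', w)` is moved to
`(x', u)`, `(x', v)`, `(x, w)`, keeping both marginals and the barycenters; the argument is
`((x, u, v), (x', w))`. -/
noncomputable def swapDiff (h : ℝ × ℝ → ℝ) (q : (ℝ × ℝ × ℝ) × (ℝ × ℝ)) : ℝ :=
  h (q.1.1, q.2.2) - h (q.2.1, q.2.2)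
    + weight q.1.2.1 q.1.2.2 q.2.2 * (h (q.2.1, q.1.2.1) - h (q.1.1, q.1.2.1))
    + (1 - weight q.1.2.1 q.1.2.2 q.2.2) * (h (q.2.1, q.1.2.2) - h (q.1.1, q.1.2.2))

lemma measurable_weight : Measurable
    (fun q : (ℝ × ℝ × ℝ) × (ℝ × ℝ) => weight q.1.2.1 q.1.2.2 q.2.2) := by
  unfold weight
  fun_prop

lemma integral_map_withDensity {α : Type*} [MeasurableSpace α] {M : Measure α}
    {s : α → ℝ} (hs : Measurable s) (hs0 : ∀ᵐ q ∂M, 0 ≤ s q)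
    {f : α → ℝ × ℝ} (hf : Measurable f) (h : ℝ × ℝ →ᵇ ℝ) :
    ∫ p, h p ∂((M.withDensity fun q => ((s q).toNNReal : ℝ≥0∞)).map f) = ∫ q, s q * h (f q) ∂M := by
  rw [integral_map hf.aemeasurable h.continuous.aestronglyMeasurable,
    integral_withDensity_eq_integral_smul hs.real_toNNReal]
  refine integral_congr_ae (hs0.mono fun q hq => ?_)
  simp [NNReal.smul_def, Real.coe_toNNReal _ hq]

lemma withDensity_toNNReal_le {α : Type*} [MeasurableSpace α] {M : Measure α}
    {s : α → ℝ} (hs1 : ∀ᵐ q ∂M, s q ≤ 1) :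
    (M.withDensity fun q => ((s q).toNNReal : ℝ≥0∞)) ≤ M := by
  calc _ ≤ M.withDensity 1 := withDensity_mono (hs1.mono fun q hq => by simpa using hq)
    _ = M := withDensity_one

/-- Moving a third of the mass described by `M` along the swaps of `swapDiff` gives a measure. -/
lemma exists_competitor {π : Measure (ℝ × ℝ)} [IsFiniteMeasure π]
    {M : Measure ((ℝ × ℝ × ℝ) × (ℝ × ℝ))} [IsFiniteMeasure M]
    (hG : ∀ᵐ q ∂M, q.1.2.1 < q.2.2 ∧ q.2.2 < q.1.2.2)
    (h1 : M.map (fun q => (q.1.1, q.1.2.1)) ≤ π) (h2 : M.map (fun q => (q.1.1, q.1.2.2)) ≤ π)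
    (h3 : M.map Prod.snd ≤ π) :
    ∃ π' : Measure (ℝ × ℝ), IsFiniteMeasure π' ∧
      ∀ h : ℝ × ℝ →ᵇ ℝ, ∫ p, h p ∂π' = ∫ p, h p ∂π + 3⁻¹ * ∫ q, swapDiff h q ∂M := by
  set s : (ℝ × ℝ × ℝ) × (ℝ × ℝ) → ℝ := fun q => weight q.1.2.1 q.1.2.2 q.2.2 with hs
  have hsm : Measurable s := measurable_weight
  have hsm' : Measurable fun q => 1 - s q := measurable_const.sub hsm
  have hs0 : ∀ᵐ q ∂M, 0 ≤ s q := hG.mono fun q hq => weight_nonneg hq.1 hq.2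
  have hs1 : ∀ᵐ q ∂M, s q ≤ 1 := hG.mono fun q hq => (weight_lt_one hq.1 hq.2).le
  have hs0' : ∀ᵐ q ∂M, 0 ≤ 1 - s q := hs1.mono fun q hq => by linarith
  have hs1' : ∀ᵐ q ∂M, 1 - s q ≤ 1 := hs0.mono fun q hq => by linarith
  set Ms := M.withDensity fun q => ((s q).toNNReal : ℝ≥0∞) with hMs
  set Mt := M.withDensity fun q => ((1 - s q).toNNReal : ℝ≥0∞) with hMt
  have hMsle : Ms ≤ M := withDensity_toNNReal_le hs1
  have hMtle : Mt ≤ M := withDensity_toNNReal_le hs1'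
  have : IsFiniteMeasure Ms := isFiniteMeasure_of_le M hMsle
  have : IsFiniteMeasure Mt := isFiniteMeasure_of_le M hMtle
  set e1 : (ℝ × ℝ × ℝ) × (ℝ × ℝ) → ℝ × ℝ := fun q => (q.1.1, q.1.2.1) with he1
  set e2 : (ℝ × ℝ × ℝ) × (ℝ × ℝ) → ℝ × ℝ := fun q => (q.1.1, q.1.2.2) with he2
  set e3 : (ℝ × ℝ × ℝ) × (ℝ × ℝ) → ℝ × ℝ := Prod.snd with he3
  set e4 : (ℝ × ℝ × ℝ) × (ℝ × ℝ) → ℝ × ℝ := fun q => (q.2.1, q.1.2.1) with he4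
  set e5 : (ℝ × ℝ × ℝ) × (ℝ × ℝ) → ℝ × ℝ := fun q => (q.2.1, q.1.2.2) with he5
  set e6 : (ℝ × ℝ × ℝ) × (ℝ × ℝ) → ℝ × ℝ := fun q => (q.1.1, q.2.2) with he6
  have me1 : Measurable e1 := by fun_prop
  have me2 : Measurable e2 := by fun_prop
  have me3 : Measurable e3 := measurable_snd
  have me4 : Measurable e4 := by fun_prop
  have me5 : Measurable e5 := by fun_prop
  have me6 : Measurable e6 := by fun_prop
  -- Each of the three pieces is dominated by `π`, their sum only by `3 π`; the factor 1/3 allows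
  -- `old` to be subtracted.
  set old := (3⁻¹ : ℝ≥0) • (Ms.map e1 + Mt.map e2 + M.map e3) with hold
  set new := (3⁻¹ : ℝ≥0) • (Ms.map e4 + Mt.map e5 + M.map e6) with hnew
  have hle : old ≤ π := by
    have hsum : Ms.map e1 + Mt.map e2 + M.map e3 ≤ (3 : ℝ≥0) • π := by
      have : (3 : ℝ≥0) • π = π + π + π := by
        rw [show (3 : ℝ≥0) = 1 + 1 + 1 by norm_num, add_smul, add_smul, one_smul]
      rw [this]
      exact add_le_add (add_le_add ((Measure.map_mono hMsle me1).trans h1)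
        ((Measure.map_mono hMtle me2).trans h2)) h3
    have hthree : (3⁻¹ : ℝ≥0) • ((3 : ℝ≥0) • π) = π := by rw [smul_smul]; norm_num
    rw [← hthree]
    refine Measure.le_iff'.2 fun t => ?_
    rw [hold, Measure.smul_apply, Measure.smul_apply]
    exact mul_le_mul_right (hsum t) _
  have hfin : IsFiniteMeasure old := isFiniteMeasure_of_le π hle
  have hπ : π - old + old = π := Measure.sub_add_cancel_of_le hle
  refine ⟨π - old + new, inferInstance, fun h => ?_⟩
  have hint : ∀ (μ : Measure (ℝ × ℝ)) [IsFiniteMeasure μ], Integrable h μ := fun μ _ =>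
    h.integrable μ
  have hL : ∫ p, h p ∂(π - old + new) = ∫ p, h p ∂(π - old) + ∫ p, h p ∂new :=
    integral_add_measure (hint _) (hint _)
  have hR : ∫ p, h p ∂π = ∫ p, h p ∂(π - old) + ∫ p, h p ∂old := by
    rw [← integral_add_measure (hint _) (hint _), hπ]
  have bd : ∀ f : (ℝ × ℝ × ℝ) × (ℝ × ℝ) → ℝ × ℝ, Measurable f →
      Integrable (fun q => h (f q)) M := fun f mf =>
    Integrable.of_bound (h.continuous.measurable.comp mf).aestronglyMeasurable ‖h‖
      (ae_of_all _ fun q => h.norm_coe_le_norm _)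
  have i1 : ∀ f : (ℝ × ℝ × ℝ) × (ℝ × ℝ) → ℝ × ℝ, Measurable f →
      Integrable (fun q => s q * h (f q)) M := fun f mf =>
    (bd f mf).bdd_mul (c := 1) hsm.aestronglyMeasurable (by
      filter_upwards [hs0, hs1] with q h0 h1
      rw [Real.norm_eq_abs, abs_of_nonneg h0]; exact h1)
  have i2 : ∀ f : (ℝ × ℝ × ℝ) × (ℝ × ℝ) → ℝ × ℝ, Measurable f →
      Integrable (fun q => (1 - s q) * h (f q)) M := fun f mf =>
    (bd f mf).bdd_mul (c := 1) hsm'.aestronglyMeasurable (by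
      filter_upwards [hs0', hs1'] with q h0 h1
      rw [Real.norm_eq_abs, abs_of_nonneg h0]; exact h1)
  have hI : ∀ {f1 f2 f3 : (ℝ × ℝ × ℝ) × (ℝ × ℝ) → ℝ × ℝ}, Measurable f1 → Measurable f2 →
      Measurable f3 →
      Integrable (fun q => s q * h (f1 q) + (1 - s q) * h (f2 q) + h (f3 q)) M :=
    fun mf1 mf2 mf3 => ((i1 _ mf1).add (i2 _ mf2)).add (bd _ mf3)
  have key : ∀ {f1 f2 f3 : (ℝ × ℝ × ℝ) × (ℝ × ℝ) → ℝ × ℝ}, Measurable f1 → Measurable f2 →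
      Measurable f3 → ∫ p, h p ∂((3⁻¹ : ℝ≥0) • (Ms.map f1 + Mt.map f2 + M.map f3)) =
        3⁻¹ * ∫ q, (s q * h (f1 q) + (1 - s q) * h (f2 q) + h (f3 q)) ∂M := by
    intro f1 f2 f3 mf1 mf2 mf3
    have e : ∫ q, (s q * h (f1 q) + (1 - s q) * h (f2 q) + h (f3 q)) ∂M =
        ∫ q, s q * h (f1 q) ∂M + ∫ q, (1 - s q) * h (f2 q) ∂M + ∫ q, h (f3 q) ∂M := by
      rw [← integral_add (i1 _ mf1) (i2 _ mf2)]
      exact integral_add ((i1 _ mf1).add (i2 _ mf2)) (bd f3 mf3)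
    rw [integral_smul_nnreal_measure, integral_add_measure (hint _) (hint _),
      integral_add_measure (hint _) (hint _), hMs, integral_map_withDensity hsm hs0 mf1, hMt,
      integral_map_withDensity hsm' hs0' mf2,
      integral_map mf3.aemeasurable h.continuous.aestronglyMeasurable, e]
    simp only [NNReal.smul_def, smul_eq_mul, NNReal.coe_inv, NNReal.coe_ofNat]
  have hswap : ∫ q, swapDiff h q ∂M =
      ∫ q, (s q * h (e4 q) + (1 - s q) * h (e5 q) + h (e6 q)) ∂M
        - ∫ q, (s q * h (e1 q) + (1 - s q) * h (e2 q) + h (e3 q)) ∂M := by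
    rw [← integral_sub (hI me4 me5 me6) (hI me1 me2 me3)]
    congr 1 with q
    simp only [swapDiff, he1, he2, he3, he4, he5, he6, hs]
    ring
  rw [hL, hR, hnew, hold, key me4 me5 me6, key me1 me2 me3, hswap]
  ring

/-! ### Couplings, disintegrations and the barycenter condition -/

lemma Couplings.isProbabilityMeasure {σX σZ : Measure ℝ} [IsProbabilityMeasure σX]
    {π : Measure (ℝ × ℝ)} (h : π ∈ Couplings σX σZ) : IsProbabilityMeasure π :=
  ⟨by rw [← Measure.fst_univ, h.1]; exact measure_univ⟩

lemma Couplings.ae_fst {σX σZ : Measure ℝ} {π : Measure (ℝ × ℝ)} (h : π ∈ Couplings σX σZ)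
    {P : ℝ → Prop} (hP : ∀ᵐ x ∂σX, P x) : ∀ᵐ p ∂π, P p.1 := by
  rw [← h.1] at hP
  exact ae_of_ae_map measurable_fst.aemeasurable hP

lemma Couplings.ae_snd {σX σZ : Measure ℝ} {π : Measure (ℝ × ℝ)} (h : π ∈ Couplings σX σZ)
    {P : ℝ → Prop} (hP : ∀ᵐ x ∂σZ, P x) : ∀ᵐ p ∂π, P p.2 := by
  rw [← h.2] at hP
  exact ae_of_ae_map measurable_snd.aemeasurable hP

lemma IsDisintegration.ae_ae {σX : Measure ℝ} [IsProbabilityMeasure σX] {π : Measure (ℝ × ℝ)}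
    {κ : Kernel ℝ ℝ} (h : IsDisintegration π σX κ) {P : ℝ × ℝ → Prop} (hP : ∀ᵐ p ∂π, P p) :
    ∀ᵐ x ∂σX, ∀ᵐ z ∂κ x, P (x, z) := by
  have := h.isMarkov
  rw [h.eq_compProd] at hP
  exact Measure.ae_ae_of_ae_compProd hP

lemma IsDisintegration.ae_eq {σX : Measure ℝ} [IsProbabilityMeasure σX] {π : Measure (ℝ × ℝ)}
    {κ κ' : Kernel ℝ ℝ} (h : IsDisintegration π σX κ) (h' : IsDisintegration π σX κ') :
    κ =ᵐ[σX] κ' := by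
  have := h.isMarkov
  have := h'.isMarkov
  exact Kernel.ae_eq_of_compProd_eq (h.eq_compProd.symm.trans h'.eq_compProd)

/-- The barycenter condition tested against bounded continuous functions of `x`. -/
lemma mem_barCouplings_iff {y : ℝ} {σX σZ : Measure ℝ} [IsProbabilityMeasure σX]
    {R : ℝ} (hR : ∀ᵐ z ∂σZ, |z - y| ≤ R) {π : Measure (ℝ × ℝ)} :
    π ∈ BarCouplings (fun _ => y) σX σZ ↔
      π ∈ Couplings σX σZ ∧ ∀ φ : ℝ →ᵇ ℝ, ∫ p, φ p.1 * (p.2 - y) ∂π = 0 := by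
  have hintπ : ∀ π ∈ Couplings σX σZ, ∀ φ : ℝ →ᵇ ℝ,
      Integrable (fun p : ℝ × ℝ => φ p.1 * (p.2 - y)) π := by
    intro π hπ φ
    have := Couplings.isProbabilityMeasure hπ
    have hm : Measurable fun p : ℝ × ℝ => φ p.1 * (p.2 - y) :=
      (φ.continuous.measurable.comp measurable_fst).mul (measurable_snd.sub_const y)
    refine Integrable.of_bound hm.aestronglyMeasurable (‖φ‖ * R) ?_
    filter_upwards [Couplings.ae_snd hπ hR] with p hp
    rw [norm_mul]
    exact mul_le_mul (φ.norm_coe_le_norm _) hp (norm_nonneg _) (norm_nonneg _)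
  refine ⟨fun ⟨hπ, κ, hκ, hbar⟩ => ⟨hπ, fun φ => ?_⟩, fun ⟨hπ, h⟩ => ⟨hπ, ?_⟩⟩
  · have := hκ.isMarkov
    have hi := hintπ π hπ φ
    rw [hκ.eq_compProd] at hi ⊢
    rw [Measure.integral_compProd hi]
    refine integral_eq_zero_of_ae ?_
    filter_upwards [hbar] with x hx
    simp only [integral_const_mul, Pi.zero_apply]
    rw [integral_sub hx.1 (integrable_const _), hx.2]
    simp
  · have := Couplings.isProbabilityMeasure hπ
    have hdis : IsDisintegration π σX π.condKernel :=
      ⟨inferInstance, by rw [← hπ.1, Measure.disintegrate]⟩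
    refine ⟨π.condKernel, hdis, ?_⟩
    have hi : Integrable (fun p : ℝ × ℝ => p.2 - y) π := by
      simpa using hintπ π hπ 1
    have hi' := hi
    rw [hdis.eq_compProd] at hi'
    have hae := ((Measure.integrable_compProd_iff hi'.aestronglyMeasurable).1 hi').1
    have hg : Integrable (fun x => ∫ z, (z - y) ∂π.condKernel x) σX := by
      have := Integrable.integral_compProd (κ := Kernel.const Unit σX) (a := ())
        (η := Kernel.prodMkLeft Unit π.condKernel) hi'
      simpa using this
    -- Smooth compactly supported functions are bounded and continuous, and already suffice to show
    -- that an integrable function vanishes almost everywhere.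
    have hzero : ∀ᵐ x ∂σX, ∫ z, (z - y) ∂π.condKernel x = 0 := by
      refine ae_eq_zero_of_integral_contDiff_smul_eq_zero hg.locallyIntegrable
        fun φ hφ hφc => ?_
      obtain ⟨C, hC⟩ := hφc.exists_bound_of_continuous hφ.continuous
      set ψ : ℝ →ᵇ ℝ := BoundedContinuousFunction.ofNormedAddCommGroup φ hφ.continuous C hC
      have h1 := h ψ
      have h2 := hintπ π hπ ψ
      rw [hdis.eq_compProd] at h1 h2
      rw [Measure.integral_compProd h2] at h1
      simp only [integral_const_mul] at h1
      exact h1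
    filter_upwards [hzero, hae] with x hx hxi
    have hz : Integrable (fun z : ℝ => z) (π.condKernel x) := by
      have := hxi.add (integrable_const y)
      refine this.congr (ae_of_all _ fun z => ?_)
      simp
    refine ⟨hz, ?_⟩
    rw [integral_sub hz (integrable_const _)] at hx
    simp only [integral_const, probReal_univ, one_smul] at hx
    exact sub_eq_zero.1 hx

/-- A bounded continuous version of the function `φ x * (z - y)`. -/
noncomputable def momentTest (φ : ℝ →ᵇ ℝ) (y R : ℝ) : ℝ × ℝ →ᵇ ℝ :=
  BoundedContinuousFunction.ofNormedAddCommGroup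
    -- Truncating at `|R|` keeps the two bounds in order for every real `R`.
    (fun p => φ p.1 * max (-|R|) (min (p.2 - y) |R|)) (by fun_prop) (‖φ‖ * |R|) fun p => by
    rw [norm_mul]
    refine mul_le_mul (φ.norm_coe_le_norm _) ?_ (norm_nonneg _) (norm_nonneg _)
    rw [Real.norm_eq_abs, abs_le]
    exact ⟨le_max_left _ _, max_le (by linarith [abs_nonneg R]) (min_le_right _ _)⟩

lemma momentTest_apply (φ : ℝ →ᵇ ℝ) {y R : ℝ} {p : ℝ × ℝ} (hp : |p.2 - y| ≤ R) :
    momentTest φ y R p = φ p.1 * (p.2 - y) := by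
  have h := abs_le.1 (hp.trans (le_abs_self R))
  change φ p.1 * max (-|R|) (min (p.2 - y) |R|) = _
  rw [min_eq_left h.2, max_eq_right h.1]

/-- Turns the barycenter condition into linear equations in `π` that are closed under weak
convergence. Compactness, the competitor and convexity all use this form. -/
lemma mem_barCouplings_iff' {y : ℝ} {σX σZ : Measure ℝ} [IsProbabilityMeasure σX]
    {R : ℝ} (hR : ∀ᵐ z ∂σZ, |z - y| ≤ R) {π : Measure (ℝ × ℝ)} :
    π ∈ BarCouplings (fun _ => y) σX σZ ↔
      π ∈ Couplings σX σZ ∧ ∀ φ : ℝ →ᵇ ℝ, ∫ p, momentTest φ y R p ∂π = 0 := by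
  rw [mem_barCouplings_iff hR]
  refine and_congr_right fun hπ => forall_congr' fun φ => ?_
  rw [integral_congr_ae]
  filter_upwards [Couplings.ae_snd hπ hR] with p hp using (momentTest_apply φ hp).symm

/-! ### Existence of a minimizer -/

/-- Fixed marginals give tightness, hence compactness by Prokhorov; the product measure is
admissible, and the objective is weakly continuous. -/
lemma exists_isMinOn_barCouplings {y : ℝ} {σX σZ : Measure ℝ} [IsProbabilityMeasure σX]
    [IsProbabilityMeasure σZ] {R : ℝ} (hR : ∀ᵐ z ∂σZ, |z - y| ≤ R) (hy : ∫ z, z ∂σZ = y)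
    (C : ℝ × ℝ →ᵇ ℝ) :
    ∃ π ∈ BarCouplings (fun _ => y) σX σZ, ∀ π' ∈ BarCouplings (fun _ => y) σX σZ,
      ∫ p, C p ∂π ≤ ∫ p, C p ∂π' := by
  set S : Set (ProbabilityMeasure (ℝ × ℝ)) := {π | (π : Measure _) ∈ Couplings σX σZ} with hS
  have htight : IsTightMeasureSet {((μ : ProbabilityMeasure (ℝ × ℝ)) : Measure (ℝ × ℝ)) | μ ∈ S} := by
    refine IsTightMeasureSet.prodMk
      ((isTightMeasureSet_singleton (μ := σX)).subset ?_)
      ((isTightMeasureSet_singleton (μ := σZ)).subset ?_)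
    · rintro _ ⟨_, ⟨μ, hμ, rfl⟩, rfl⟩
      exact hμ.1
    · rintro _ ⟨_, ⟨μ, hμ, rfl⟩, rfl⟩
      exact hμ.2
  have hSclosed : IsClosed S := by
    have : S = (fun π : ProbabilityMeasure (ℝ × ℝ) => π.map (f := Prod.fst) (by fun_prop)) ⁻¹'
          {⟨σX, inferInstance⟩} ∩
        (fun π : ProbabilityMeasure (ℝ × ℝ) => π.map (f := Prod.snd) (by fun_prop)) ⁻¹'
          {⟨σZ, inferInstance⟩} := by
      ext π
      exact ⟨fun h => ⟨Subtype.ext h.1, Subtype.ext h.2⟩,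
        fun h => ⟨congrArg Subtype.val h.1, congrArg Subtype.val h.2⟩⟩
    rw [this]
    exact (isClosed_singleton.preimage (ProbabilityMeasure.continuous_map continuous_fst)).inter
      (isClosed_singleton.preimage (ProbabilityMeasure.continuous_map continuous_snd))
  set B : Set (ProbabilityMeasure (ℝ × ℝ)) :=
    {π | (π : Measure _) ∈ BarCouplings (fun _ => y) σX σZ} with hB
  have hBeq : B = S ∩ ⋂ φ : ℝ →ᵇ ℝ,
      {π : ProbabilityMeasure (ℝ × ℝ) | ∫ p, momentTest φ y R p ∂(π : Measure _) = 0} := by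
    ext π
    simp only [hB, mem_ofPred_eq, mem_barCouplings_iff' hR, mem_inter_iff, mem_iInter, hS]
  have hcompact : IsCompact B := by
    have hScomp : IsCompact S := by
      have := isCompact_closure_of_isTightMeasureSet htight
      rwa [hSclosed.closure_eq] at this
    rw [hBeq]
    exact hScomp.inter_right (isClosed_iInter fun φ => isClosed_singleton.preimage
      (ProbabilityMeasure.continuous_integral_boundedContinuousFunction (momentTest φ y R)))
  have hintZ : Integrable (fun z : ℝ => z) σZ := by
    have : Integrable (fun z : ℝ => z - y) σZ :=
      Integrable.of_bound (by fun_prop) R hR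
    exact (this.add (integrable_const y)).congr (ae_of_all _ fun z => by simp)
  have hne : B.Nonempty := by
    refine ⟨⟨σX.prod σZ, inferInstance⟩, ⟨by simp, by simp⟩, Kernel.const ℝ σZ,
      ⟨inferInstance, Measure.compProd_const.symm⟩, ae_of_all _ fun x => ?_⟩
    simpa using ⟨hintZ, hy⟩
  obtain ⟨π, hπ, hmin⟩ := hcompact.exists_isMinOn hne
    (ProbabilityMeasure.continuous_integral_boundedContinuousFunction C).continuousOn
  refine ⟨π, hπ, fun π' hπ' => ?_⟩
  have := Couplings.isProbabilityMeasure hπ'.1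
  exact hmin (show (⟨π', this⟩ : ProbabilityMeasure (ℝ × ℝ)) ∈ B from hπ')

lemma integrable_swapDiff {M : Measure ((ℝ × ℝ × ℝ) × (ℝ × ℝ))} [IsFiniteMeasure M]
    (hG : ∀ᵐ q ∂M, q.1.2.1 < q.2.2 ∧ q.2.2 < q.1.2.2) (h : ℝ × ℝ →ᵇ ℝ) :
    Integrable (swapDiff h) M := by
  have hm := h.continuous.measurable
  have hw := measurable_weight
  have hd : ∀ p p', |h p - h p'| ≤ 2 * ‖h‖ := fun p p' => by
    simpa [Real.dist_eq] using h.dist_le_two_norm p p'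
  refine Integrable.of_bound (C := 2 * ‖h‖ + 2 * ‖h‖ + 2 * ‖h‖) ?_ ?_
  · refine Measurable.aestronglyMeasurable ?_
    unfold swapDiff
    fun_prop
  · filter_upwards [hG] with q hq
    have h0 := weight_nonneg hq.1 hq.2
    have h1 := weight_lt_one hq.1 hq.2
    rw [Real.norm_eq_abs, swapDiff]
    refine (abs_add_le _ _).trans (add_le_add ((abs_add_le _ _).trans (add_le_add (hd _ _) ?_)) ?_)
    · rw [abs_mul, abs_of_nonneg h0]
      exact (mul_le_of_le_one_left (abs_nonneg _) h1.le).trans (hd _ _)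
    · rw [abs_mul, abs_of_nonneg (by linarith)]
      exact (mul_le_of_le_one_left (abs_nonneg _) (by linarith)).trans (hd _ _)

/-- Under a minimizer, almost no mass is moved by strictly improving swaps. -/
lemma ae_not_swap {y : ℝ} {σX σZ : Measure ℝ} [IsProbabilityMeasure σX]
    [IsProbabilityMeasure σZ] {R : ℝ} (hR : ∀ᵐ z ∂σZ, |z - y| ≤ R)
    {X Z : Set ℝ} (hX : ∀ᵐ x ∂σX, x ∈ X) (hZ : ∀ᵐ z ∂σZ, z ∈ Z)
    {c : ℝ → ℝ → ℝ} (hSM : MartingaleSpenceMirrlees X Z c)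
    {C : ℝ × ℝ →ᵇ ℝ} (hC : ∀ p ∈ X ×ˢ Z, C p = c p.1 p.2)
    {π : Measure (ℝ × ℝ)} (hπ : π ∈ BarCouplings (fun _ => y) σX σZ)
    (hmin : ∀ π' ∈ BarCouplings (fun _ => y) σX σZ, ∫ p, C p ∂π ≤ ∫ p, C p ∂π')
    {κ : Kernel ℝ ℝ} (hκ : IsDisintegration π σX κ) :
    ∀ᵐ x ∂σX, ∀ᵐ u ∂κ x, ∀ᵐ v ∂κ x, ∀ᵐ p ∂π, ¬ (x < p.1 ∧ u < p.2 ∧ p.2 < v) := by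
  have := hκ.isMarkov
  have := Couplings.isProbabilityMeasure hπ.1
  -- Given `x`, the points `u` and `v` are drawn independently from `κ x`, and `(x', w)`
  -- independently from `π`. Each of `(x, u)`, `(x, v)`, `(x', w)` then has law `π`, so restricting
  -- `τ` to the improving configurations `G` gives an admissible `M` for `exists_competitor`.
  set τ : Measure ((ℝ × ℝ × ℝ) × (ℝ × ℝ)) := (σX ⊗ₘ (κ ×ₖ κ)).prod π with hτ
  set G : Set ((ℝ × ℝ × ℝ) × (ℝ × ℝ)) :=
    {q | q.1.1 < q.2.1 ∧ q.1.2.1 < q.2.2 ∧ q.2.2 < q.1.2.2} with hG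
  have hGm : MeasurableSet G := by
    have l1 : MeasurableSet {q : (ℝ × ℝ × ℝ) × (ℝ × ℝ) | q.1.1 < q.2.1} :=
      measurableSet_lt (by fun_prop) (by fun_prop)
    have l2 : MeasurableSet {q : (ℝ × ℝ × ℝ) × (ℝ × ℝ) | q.1.2.1 < q.2.2} :=
      measurableSet_lt (by fun_prop) (by fun_prop)
    have l3 : MeasurableSet {q : (ℝ × ℝ × ℝ) × (ℝ × ℝ) | q.2.2 < q.1.2.2} :=
      measurableSet_lt (by fun_prop) (by fun_prop)
    exact l1.inter (l2.inter l3)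
  have hτ1 : τ.map (fun q => (q.1.1, q.1.2.1)) = π := by
    have : (fun q : (ℝ × ℝ × ℝ) × (ℝ × ℝ) => (q.1.1, q.1.2.1)) = Prod.map id Prod.fst ∘ Prod.fst :=
      rfl
    rw [this, ← Measure.map_map (by fun_prop) (by fun_prop), hτ, Measure.map_fst_prod,
      measure_univ, one_smul, ← Measure.compProd_map measurable_fst, ← Kernel.fst_eq,
      Kernel.fst_prod, ← hκ.eq_compProd]
  have hτ2 : τ.map (fun q => (q.1.1, q.1.2.2)) = π := by
    have : (fun q : (ℝ × ℝ × ℝ) × (ℝ × ℝ) => (q.1.1, q.1.2.2)) = Prod.map id Prod.snd ∘ Prod.fst :=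
      rfl
    rw [this, ← Measure.map_map (by fun_prop) (by fun_prop), hτ, Measure.map_fst_prod,
      measure_univ, one_smul, ← Measure.compProd_map measurable_snd, ← Kernel.snd_eq,
      Kernel.snd_prod, ← hκ.eq_compProd]
  have hτ3 : τ.map Prod.snd = π := by
    rw [hτ, Measure.map_snd_prod, measure_univ, one_smul]
  set M := τ.restrict G with hM
  have hMG : ∀ᵐ q ∂M, q ∈ G := ae_restrict_mem hGm
  have h1 : M.map (fun q => (q.1.1, q.1.2.1)) ≤ π :=
    (Measure.map_mono Measure.restrict_le_self (by fun_prop)).trans hτ1.le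
  have h2 : M.map (fun q => (q.1.1, q.1.2.2)) ≤ π :=
    (Measure.map_mono Measure.restrict_le_self (by fun_prop)).trans hτ2.le
  have h3 : M.map Prod.snd ≤ π :=
    (Measure.map_mono Measure.restrict_le_self (by fun_prop)).trans hτ3.le
  have hae : ∀ {P Q : ℝ → Prop}, (∀ᵐ x ∂σX, P x) → (∀ᵐ z ∂σZ, Q z) →
      ∀ᵐ q ∂M, P q.1.1 ∧ P q.2.1 ∧ Q q.1.2.1 ∧ Q q.1.2.2 ∧ Q q.2.2 := by
    intro P Q hP hQ
    have hPQ : ∀ᵐ p ∂π, P p.1 ∧ Q p.2 :=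
      (Couplings.ae_fst hπ.1 hP).and (Couplings.ae_snd hπ.1 hQ)
    filter_upwards [ae_of_ae_map (by fun_prop) (h1.absolutelyContinuous.ae_le hPQ),
      ae_of_ae_map (by fun_prop) (h2.absolutelyContinuous.ae_le hPQ),
      ae_of_ae_map (by fun_prop) (h3.absolutelyContinuous.ae_le hPQ)] with q q1 q2 q3
    exact ⟨q1.1, q3.1, q1.2, q2.2, q3.2⟩
  have hMG' : ∀ᵐ q ∂M, q.1.2.1 < q.2.2 ∧ q.2.2 < q.1.2.2 := hMG.mono fun q hq => hq.2
  obtain ⟨π', hfin, hπ'⟩ := exists_competitor hMG' h1 h2 h3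
  -- Functions of `x` alone, functions of `z` alone and the moment tests have zero `swapDiff` almost
  -- everywhere, so the competitor stays admissible.
  have hzero : ∀ h : ℝ × ℝ →ᵇ ℝ, (∀ᵐ q ∂M, swapDiff h q = 0) →
      ∫ p, h p ∂π' = ∫ p, h p ∂π := by
    intro h hh
    rw [hπ' h, integral_eq_zero_of_ae hh, mul_zero, add_zero]
  have hcoup : π' ∈ Couplings σX σZ := by
    constructor
    · rw [← hπ.1.1]
      refine ext_of_forall_integral_eq_of_IsFiniteMeasure fun f => ?_
      rw [Measure.fst, Measure.fst, integral_map (by fun_prop) f.continuous.aestronglyMeasurable,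
        integral_map (by fun_prop) f.continuous.aestronglyMeasurable]
      refine hzero (f.compContinuous ⟨Prod.fst, continuous_fst⟩) (ae_of_all _ fun q => ?_)
      simp only [swapDiff, BoundedContinuousFunction.compContinuous_apply, ContinuousMap.coe_mk]
      ring
    · rw [← hπ.1.2]
      refine ext_of_forall_integral_eq_of_IsFiniteMeasure fun f => ?_
      rw [Measure.snd, Measure.snd, integral_map (by fun_prop) f.continuous.aestronglyMeasurable,
        integral_map (by fun_prop) f.continuous.aestronglyMeasurable]
      refine hzero (f.compContinuous ⟨Prod.snd, continuous_snd⟩) (ae_of_all _ fun q => ?_)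
      simp only [swapDiff, BoundedContinuousFunction.compContinuous_apply, ContinuousMap.coe_mk]
      ring
  have hbar : π' ∈ BarCouplings (fun _ => y) σX σZ := by
    refine (mem_barCouplings_iff' hR).2 ⟨hcoup, fun φ => ?_⟩
    rw [hzero, ((mem_barCouplings_iff' hR).1 hπ).2 φ]
    filter_upwards [hMG', hae (ae_of_all _ fun _ => trivial) hR] with q hq hb
    obtain ⟨-, -, b1, b2, b3⟩ := hb
    simp only [swapDiff, fun x => momentTest_apply φ (p := (x, q.1.2.1)) b1,
      fun x => momentTest_apply φ (p := (x, q.1.2.2)) b2,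
      fun x => momentTest_apply φ (p := (x, q.2.2)) b3]
    have e := weight_combination hq.1 hq.2
    linear_combination (φ q.2.1 - φ q.1.1) * e
  have hneg : ∀ᵐ q ∂M, swapDiff C q < 0 := by
    filter_upwards [hMG, hae hX hZ] with q hq hb
    obtain ⟨x1, x2, u, v, w⟩ := hb
    have e := weight_combination hq.2.1 hq.2.2
    have := hSM x1 x2 hq.1 u v (hq.2.1.trans hq.2.2).ne (weight_pos hq.2.1 hq.2.2)
      (sub_pos.2 (weight_lt_one hq.2.1 hq.2.2)) (by ring) (by rwa [e])
    rw [e] at this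
    rw [swapDiff, hC (q.1.1, q.2.2) ⟨x1, w⟩, hC (q.2.1, q.2.2) ⟨x2, w⟩,
      hC (q.2.1, q.1.2.1) ⟨x2, u⟩, hC (q.1.1, q.1.2.1) ⟨x1, u⟩,
      hC (q.2.1, q.1.2.2) ⟨x2, v⟩, hC (q.1.1, q.1.2.2) ⟨x1, v⟩]
    linarith
  -- Minimality makes the integral of the strictly negative `swapDiff C` nonnegative, so `M` must
  -- vanish.
  have hM0 : ∀ᵐ q ∂M, False := by
    have hle : 0 ≤ ∫ q, swapDiff C q ∂M := by
      have := hmin π' hbar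
      rw [hπ' C] at this
      linarith
    have hi := integrable_swapDiff hMG' C
    have hle' : ∫ q, -swapDiff C q ∂M = 0 := by
      refine le_antisymm ?_ (integral_nonneg_of_ae (hneg.mono fun q hq => by
        simpa using hq.le))
      rw [integral_neg]
      linarith
    have h0 := (integral_eq_zero_iff_of_nonneg_ae
      (hneg.mono fun q hq => by simpa using hq.le) hi.neg).1 hle'
    filter_upwards [h0, hneg] with q q0 q1
    have : -swapDiff C q = 0 := q0
    linarith
  have hτG : ∀ᵐ q ∂τ, q ∉ G := (ae_restrict_iff' hGm).1 hM0
  filter_upwards [Measure.ae_ae_of_ae_compProd (Measure.ae_ae_of_ae_prod hτG)] with x hx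
  rw [Kernel.prod_apply] at hx
  exact Measure.ae_ae_of_ae_prod hx

/-! ### Two-point conditionals and monotone graphs -/

/-- A probability measure on two points is determined by its mean. -/
lemma eq_two_diracs_of_mean {μ : Measure ℝ} [IsProbabilityMeasure μ] {s t y : ℝ} (hst : s < t)
    (hsy : s ≤ y) (hyt : y ≤ t) (hμ : ∀ᵐ z ∂μ, z = s ∨ z = t) (hmean : ∫ z, z ∂μ = y) :
    μ = ((t - y) / (t - s)).toNNReal • Measure.dirac s
      + ((y - s) / (t - s)).toNNReal • Measure.dirac t := by
  have hdec : μ = (μ {s}).toNNReal • Measure.dirac s + (μ {t}).toNNReal • Measure.dirac t := by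
    have h1 : μ.restrict ({s} ∪ {t}) = μ := Measure.restrict_eq_self_of_ae_mem hμ
    have h2 : ∀ a : ℝ, μ.restrict {a} = (μ {a}).toNNReal • Measure.dirac a := fun a => by
      rw [Measure.restrict_singleton]
      conv_lhs => rw [← ENNReal.coe_toNNReal (measure_ne_top μ {a})]
      rfl
    rw [Measure.restrict_union (by simpa using hst.ne) (measurableSet_singleton t), h2, h2] at h1
    exact h1.symm
  set α := (μ {s}).toNNReal with hα
  set β := (μ {t}).toNNReal with hβ
  have hsum : (α : ℝ) + β = 1 := by
    have h := measure_univ (μ := μ)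
    rw [hdec] at h
    simp only [Measure.add_apply, Measure.smul_apply, measure_univ] at h
    have : ((α + β : ℝ≥0) : ℝ≥0∞) = 1 := by simpa [ENNReal.smul_def] using h
    exact_mod_cast this
  have hm : (α : ℝ) * s + β * t = y := by
    rw [← hmean, hdec, integral_add_measure, integral_smul_nnreal_measure,
      integral_smul_nnreal_measure, integral_dirac, integral_dirac]
    · simp [NNReal.smul_def]
    · exact (integrable_dirac (by simp)).smul_measure_nnreal
    · exact (integrable_dirac (by simp)).smul_measure_nnreal
  have hts : t - s ≠ 0 := by linarith
  have eα : α = ((t - y) / (t - s)).toNNReal := by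
    refine NNReal.coe_injective ?_
    rw [Real.coe_toNNReal _ (div_nonneg (by linarith) (by linarith)), eq_div_iff hts]
    linear_combination t * hsum - hm
  have eβ : β = ((y - s) / (t - s)).toNNReal := by
    refine NNReal.coe_injective ?_
    rw [Real.coe_toNNReal _ (div_nonneg (by linarith) (by linarith)), eq_div_iff hts]
    linear_combination hm - s * hsum
  rw [← eα, ← eβ]
  exact hdec

/-- The swap condition fixes the left point first, while `exists_monotone_ae_eq` fixes the right one
first; Fubini for null sets reverses the order. -/
lemma IsDisintegration.ae_ae_swap {σX : Measure ℝ} [IsProbabilityMeasure σX]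
    {π : Measure (ℝ × ℝ)} [IsFiniteMeasure π]
    {κ : Kernel ℝ ℝ} (hκ : IsDisintegration π σX κ) {P : ℝ × ℝ → ℝ × ℝ → Prop}
    (hP : MeasurableSet {q : (ℝ × ℝ) × (ℝ × ℝ) | P q.1 q.2})
    (h : ∀ᵐ x ∂σX, ∀ᵐ z ∂κ x, ∀ᵐ p ∂π, P (x, z) p) :
    ∀ᵐ p ∂π, ∀ᵐ q ∂π, P q p := by
  have := hκ.isMarkov
  refine (Measure.ae_ae_comm hP).1 ?_
  have hm : MeasurableSet {q : ℝ × ℝ | ∀ᵐ p ∂π, P q p} :=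
    measurable_measure_prodMk_left hP.compl (measurableSet_singleton 0)
  have := Measure.ae_compProd_of_ae_ae hm h
  rwa [← hκ.eq_compProd] at this

section Structure

variable {z₁ z₂ z₃ z₄ y : ℝ}

/-- Without mass on the right, the mean would be at most `z₂ < y`. -/
lemma frequently_mem_right {μ : Measure ℝ} [IsProbabilityMeasure μ] (hz₂ : z₂ < y)
    (hZ : ∀ᵐ z ∂μ, z ∈ Icc z₁ z₂ ∪ Icc z₃ z₄) (hi : Integrable (fun z : ℝ => z) μ)
    (hmean : ∫ z, z ∂μ = y) : ∃ᵐ z ∂μ, z ∈ Icc z₃ z₄ := by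
  intro h
  have : ∫ z, z ∂μ ≤ ∫ _, z₂ ∂μ := by
    refine integral_mono_ae hi (integrable_const _) ?_
    filter_upwards [hZ, h] with z h1 h2
    exact (h1.resolve_right h2).2
  simp at this
  linarith

lemma frequently_mem_left {μ : Measure ℝ} [IsProbabilityMeasure μ] (hz₃ : y < z₃)
    (hZ : ∀ᵐ z ∂μ, z ∈ Icc z₁ z₂ ∪ Icc z₃ z₄) (hi : Integrable (fun z : ℝ => z) μ)
    (hmean : ∫ z, z ∂μ = y) : ∃ᵐ z ∂μ, z ∈ Icc z₁ z₂ := by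
  intro h
  have : ∫ _, z₃ ∂μ ≤ ∫ z, z ∂μ := by
    refine integral_mono_ae (integrable_const _) hi ?_
    filter_upwards [hZ, h] with z h1 h2
    exact (h1.resolve_left h2).1
  simp at this
  linarith

/-- A coupling with barycenter `y` that admits no improving swaps is concentrated on the
graphs of two monotone maps. -/
lemma exists_monotone_graphs {σX σZ : Measure ℝ} [IsProbabilityMeasure σX]
    [NullSingletonClass σX] (hZ : ∀ᵐ z ∂σZ, z ∈ Icc z₁ z₂ ∪ Icc z₃ z₄)
    (hz₂ : z₂ < y) (hz₃ : y < z₃) {π : Measure (ℝ × ℝ)}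
    (hπ : π ∈ Couplings σX σZ) {κ : Kernel ℝ ℝ} (hκ : IsDisintegration π σX κ)
    (hbar : ∀ᵐ x ∂σX, Integrable (fun z : ℝ => z) (κ x) ∧ ∫ z, z ∂(κ x) = y)
    (hswap : ∀ᵐ x ∂σX, ∀ᵐ u ∂κ x, ∀ᵐ v ∂κ x, ∀ᵐ p ∂π,
      ¬ (x < p.1 ∧ u < p.2 ∧ p.2 < v)) :
    ∃ Tm Tp : ℝ → ℝ, (∀ x, Tm x ∈ Icc z₁ z₂) ∧ (∀ x, Tp x ∈ Icc z₃ z₄) ∧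
      Antitone Tm ∧ Monotone Tp ∧ ∀ᵐ p ∂π, p.2 = Tm p.1 ∨ p.2 = Tp p.1 := by
  have := hκ.isMarkov
  have := Couplings.isProbabilityMeasure hπ
  have hZπ := Couplings.ae_snd hπ hZ
  have hfreq : ∀ᵐ x ∂σX, (∃ᵐ z ∂κ x, z ∈ Icc z₁ z₂) ∧ ∃ᵐ z ∂κ x, z ∈ Icc z₃ z₄ := by
    filter_upwards [hκ.ae_ae hZπ, hbar] with x hx hb
    exact ⟨frequently_mem_left hz₃ hx hb.1 hb.2, frequently_mem_right hz₂ hx hb.1 hb.2⟩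
  -- No order of the endpoints is assumed; it follows because both intervals are charged.
  obtain ⟨h12, h34⟩ : z₁ ≤ z₂ ∧ z₃ ≤ z₄ := by
    obtain ⟨x, hx⟩ := hfreq.exists
    obtain ⟨u, hu⟩ := hx.1.exists
    obtain ⟨v, hv⟩ := hx.2.exists
    exact ⟨hu.1.trans hu.2, hv.1.trans hv.2⟩
  have hmsnd : ∀ l h : ℝ, MeasurableSet {p : ℝ × ℝ | p.2 ∈ Icc l h} := fun l h =>
    measurable_snd measurableSet_Icc
  have hnull : ∀ (A : Set (ℝ × ℝ)) (x : ℝ), (π.restrict A) (Prod.fst ⁻¹' {x}) = 0 := by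
    intro A x
    refine le_antisymm ((Measure.restrict_le_self _).trans ?_) zero_le
    rw [← Measure.fst_apply (measurableSet_singleton x), hπ.1, measure_singleton]
  have hmpair : ∀ (l h : ℝ) {D : Set ((ℝ × ℝ) × (ℝ × ℝ))}, MeasurableSet D →
      MeasurableSet {q : (ℝ × ℝ) × (ℝ × ℝ) | q.1.2 ∈ Icc l h → q.2.2 ∈ Icc l h →
        q.1.1 < q.2.1 → q ∈ D} := by
    intro l h D hD
    have m1 : MeasurableSet {q : (ℝ × ℝ) × (ℝ × ℝ) | q.1.2 ∈ Icc l h} :=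
      measurable_fst (hmsnd l h)
    have m2 : MeasurableSet {q : (ℝ × ℝ) × (ℝ × ℝ) | q.2.2 ∈ Icc l h} :=
      measurable_snd (hmsnd l h)
    have m3 : MeasurableSet {q : (ℝ × ℝ) × (ℝ × ℝ) | q.1.1 < q.2.1} :=
      measurableSet_lt (by fun_prop) (by fun_prop)
    exact m1.imp (m2.imp (m3.imp hD))
  have hright : ∀ᵐ p ∂π, ∀ᵐ q ∂π, q.2 ∈ Icc z₃ z₄ → p.2 ∈ Icc z₃ z₄ → q.1 < p.1 → q.2 ≤ p.2 := by
    refine hκ.ae_ae_swap (P := fun q p => q.2 ∈ Icc z₃ z₄ → p.2 ∈ Icc z₃ z₄ → q.1 < p.1 →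
      q.2 ≤ p.2) (hmpair z₃ z₄ (D := {q | q.1.2 ≤ q.2.2})
        (measurableSet_le (by fun_prop) (by fun_prop))) ?_
    filter_upwards [hswap, hfreq] with x hx hf
    -- A charged `u` in the left interval lies below all of the right one, so `p.2 < v` would
    -- complete a swap.
    obtain ⟨u, hu, hxu⟩ := (hf.1.and_eventually hx).exists
    filter_upwards [hxu] with v hv
    filter_upwards [hv] with p hp _ hp2 hlt
    by_contra hcon
    exact hp ⟨hlt, by linarith [hu.2, hp2.1], not_le.1 hcon⟩
  have hleft : ∀ᵐ p ∂π, ∀ᵐ q ∂π, q.2 ∈ Icc z₁ z₂ → p.2 ∈ Icc z₁ z₂ → q.1 < p.1 → p.2 ≤ q.2 := by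
    refine hκ.ae_ae_swap (P := fun q p => q.2 ∈ Icc z₁ z₂ → p.2 ∈ Icc z₁ z₂ → q.1 < p.1 →
      p.2 ≤ q.2) (hmpair z₁ z₂ (D := {q | q.2.2 ≤ q.1.2})
        (measurableSet_le (by fun_prop) (by fun_prop))) ?_
    filter_upwards [hswap, hfreq] with x hx hf
    filter_upwards [hx] with u hu
    -- Mirror image: a charged `v` in the right interval serves as the upper outer point.
    obtain ⟨v, hv, hxv⟩ := (hf.2.and_eventually hu).exists
    filter_upwards [hxv] with p hp _ hp2 hlt
    by_contra hcon
    exact hp ⟨hlt, not_le.1 hcon, by linarith [hv.1, hp2.2]⟩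
  obtain ⟨Tp, hTp, hTp', hTpπ⟩ := exists_monotone_ae_eq (X := Prod.fst) (Y := Prod.snd)
    (hnull {p | p.2 ∈ Icc z₃ z₄}) h34 (ae_restrict_mem (hmsnd _ _)) (by
      rw [ae_restrict_iff' (hmsnd _ _)]
      filter_upwards [hright] with p hp hp2
      rw [ae_restrict_iff' (hmsnd _ _)]
      filter_upwards [hp] with q hq hq2 using hq hq2 hp2)
  -- Negating the second coordinate reduces the non-increasing case to the monotone one.
  obtain ⟨T, hT, hT', hTπ⟩ := exists_monotone_ae_eq (X := Prod.fst) (Y := fun p => -p.2)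
    (hnull {p | p.2 ∈ Icc z₁ z₂}) (neg_le_neg h12)
    ((ae_restrict_mem (hmsnd _ _)).mono fun p hp => ⟨neg_le_neg hp.2, neg_le_neg hp.1⟩) (by
      rw [ae_restrict_iff' (hmsnd _ _)]
      filter_upwards [hleft] with p hp hp2
      rw [ae_restrict_iff' (hmsnd _ _)]
      filter_upwards [hp] with q hq hq2 hlt using neg_le_neg (hq hq2 hp2 hlt))
  rw [ae_restrict_iff' (hmsnd _ _)] at hTpπ hTπ
  refine ⟨fun x => -T x, Tp, fun x => ⟨le_neg.1 (hT' x).2, neg_le.1 (hT' x).1⟩, hTp', hT.neg, hTp,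
    ?_⟩
  filter_upwards [hZπ, hTpπ, hTπ] with p hp h1 h2
  exact hp.imp (fun h => by rw [← h2 h, neg_neg]) h1

/-- If a barycenter coupling is concentrated on two graphs on either side of `y`, its
conditional probabilities are explicit. -/
lemma ae_eq_two_diracs {σX : Measure ℝ} [IsProbabilityMeasure σX] {π : Measure (ℝ × ℝ)}
    {κ : Kernel ℝ ℝ} (hκ : IsDisintegration π σX κ)
    (hbar : ∀ᵐ x ∂σX, Integrable (fun z : ℝ => z) (κ x) ∧ ∫ z, z ∂(κ x) = y)
    {Tm Tp : ℝ → ℝ} (hTm : ∀ x, Tm x < y) (hTp : ∀ x, y < Tp x)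
    (hT : ∀ᵐ p ∂π, p.2 = Tm p.1 ∨ p.2 = Tp p.1) :
    ∀ᵐ x ∂σX, κ x = ((Tp x - y) / (Tp x - Tm x)).toNNReal • Measure.dirac (Tm x)
      + ((y - Tm x) / (Tp x - Tm x)).toNNReal • Measure.dirac (Tp x) := by
  have := hκ.isMarkov
  filter_upwards [hκ.ae_ae hT, hbar] with x hx hb
  exact eq_two_diracs_of_mean ((hTm x).trans (hTp x)) (hTm x).le (hTp x).le hx hb.2

end Structure

/-! ### Uniqueness by averaging, and the main theorem -/

/-- Tietze extension. It replaces the cost by a function that weak convergence can test; the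
integrals do not change, since every coupling lives on the compact set. -/
lemma exists_boundedContinuous_eqOn {K : Set (ℝ × ℝ)} (hK : IsCompact K) {f : ℝ × ℝ → ℝ}
    (hf : ContinuousOn f K) : ∃ C : ℝ × ℝ →ᵇ ℝ, ∀ p ∈ K, C p = f p := by
  have := isCompact_iff_compactSpace.1 hK
  obtain ⟨C, -, hC⟩ := BoundedContinuousFunction.exists_norm_eq_domRestrict_eq_of_closed
    (BoundedContinuousFunction.mkOfCompact ⟨K.domRestrict f, hf.domRestrict⟩) hK.isClosed
  exact ⟨C, fun p hp => DFunLike.congr_fun hC ⟨p, hp⟩⟩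

lemma abs_sub_le_of_mem_union {z₁ z₂ z₃ z₄ y z : ℝ} (hz : z ∈ Icc z₁ z₂ ∪ Icc z₃ z₄) :
    |z - y| ≤ |z₁| + |z₂| + |z₃| + |z₄| + |y| := by
  have h1 := abs_nonneg z₁
  have h2 := abs_nonneg z₂
  have h3 := abs_nonneg z₃
  have h4 := abs_nonneg z₄
  rw [abs_le]
  rcases hz with hz | hz <;> constructor <;>
    linarith [hz.1, hz.2, neg_abs_le z₁, le_abs_self z₂, neg_abs_le z₃, le_abs_self z₄,
      neg_abs_le y, le_abs_self y]

lemma average_mem_barCouplings {y : ℝ} {σX σZ : Measure ℝ} [IsProbabilityMeasure σX]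
    {R : ℝ} (hR : ∀ᵐ z ∂σZ, |z - y| ≤ R) {π₁ π₂ : Measure (ℝ × ℝ)}
    (h₁ : π₁ ∈ BarCouplings (fun _ => y) σX σZ) (h₂ : π₂ ∈ BarCouplings (fun _ => y) σX σZ) :
    (2⁻¹ : ℝ≥0) • (π₁ + π₂) ∈ BarCouplings (fun _ => y) σX σZ := by
  have := Couplings.isProbabilityMeasure h₁.1
  have := Couplings.isProbabilityMeasure h₂.1
  have half : ∀ σ : Measure ℝ, (2⁻¹ : ℝ≥0) • (σ + σ) = σ := fun σ => by
    rw [← two_smul ℝ≥0 σ, smul_smul, inv_mul_cancel₀ two_ne_zero, one_smul]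
  refine (mem_barCouplings_iff' hR).2 ⟨⟨?_, ?_⟩, fun φ => ?_⟩
  · rw [Measure.fst, Measure.map_smul, Measure.map_add _ _ measurable_fst]
    have e₁ : π₁.map Prod.fst = σX := h₁.1.1
    have e₂ : π₂.map Prod.fst = σX := h₂.1.1
    rw [e₁, e₂, half]
  · rw [Measure.snd, Measure.map_smul, Measure.map_add _ _ measurable_snd]
    have e₁ : π₁.map Prod.snd = σZ := h₁.1.2
    have e₂ : π₂.map Prod.snd = σZ := h₂.1.2
    rw [e₁, e₂, half]
  · rw [integral_smul_nnreal_measure,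
      integral_add_measure ((momentTest φ y R).integrable _) ((momentTest φ y R).integrable _),
      ((mem_barCouplings_iff' hR).1 h₁).2 φ, ((mem_barCouplings_iff' hR).1 h₂).2 φ, add_zero,
      smul_zero]

end FixedBarycenter

open FixedBarycenter in
theorem mainTheorem3
    (a b z₁ z₂ z₃ z₄ : ℝ)
    (σX σZ : Measure ℝ) [IsProbabilityMeasure σX] [IsProbabilityMeasure σZ]
    -- `X = [a, b]` carries `σX`, and `Z = [z₁, z₂] ∪ [z₃, z₄]` carries `σZ`
    (hX : ∀ᵐ x ∂σX, x ∈ Icc a b)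
    (hZ : ∀ᵐ z ∂σZ, z ∈ Icc z₁ z₂ ∪ Icc z₃ z₄)
    -- the mean of `σZ` lies strictly between the two intervals
    (hz₂ : z₂ < ∫ z, z ∂σZ) (hz₃ : ∫ z, z ∂σZ < z₃)
    [NullSingletonClass σX]
    (c : ℝ → ℝ → ℝ)
    (hc : ContinuousOn (fun p : ℝ × ℝ => c p.1 p.2)
      (Icc a b ×ˢ (Icc z₁ z₂ ∪ Icc z₃ z₄)))
    (hSM : FixedBarycenter.MartingaleSpenceMirrlees (Icc a b) (Icc z₁ z₂ ∪ Icc z₃ z₄) c) :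
    (∃! π : Measure (ℝ × ℝ), FixedBarycenter.IsSolution c σX σZ π) ∧
    ∀ π : Measure (ℝ × ℝ), FixedBarycenter.IsSolution c σX σZ π →
      ∃ Tm Tp : ℝ → ℝ,
        MapsTo Tm (Icc a b) (Icc z₁ z₂) ∧ MapsTo Tp (Icc a b) (Icc z₃ z₄) ∧
        AntitoneOn Tm (Icc a b) ∧ MonotoneOn Tp (Icc a b) ∧
        (∀ᵐ p ∂π, p.2 = Tm p.1 ∨ p.2 = Tp p.1) ∧
        ∀ κ : Kernel ℝ ℝ, FixedBarycenter.IsDisintegration π σX κ →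
          ∀ᵐ x ∂σX, ∃ αm αp : ℝ≥0, 0 < αm ∧ 0 < αp ∧ αm + αp = 1 ∧
            κ x = αm • Measure.dirac (Tm x) + αp • Measure.dirac (Tp x) := by
  unfold IsSolution
  generalize hy : ∫ z, z ∂σZ = y at *
  obtain ⟨C, hC⟩ := exists_boundedContinuous_eqOn
    (isCompact_Icc.prod (isCompact_Icc.union isCompact_Icc)) hc
  set R := |z₁| + |z₂| + |z₃| + |z₄| + |y|
  have hR : ∀ᵐ z ∂σZ, |z - y| ≤ R := hZ.mono fun z hz => abs_sub_le_of_mem_union hz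
  have hcost : ∀ π ∈ BarCouplings (fun _ => y) σX σZ, ∫ p, c p.1 p.2 ∂π = ∫ p, C p ∂π := by
    intro π hπ
    refine integral_congr_ae ?_
    filter_upwards [Couplings.ae_fst hπ.1 hX, Couplings.ae_snd hπ.1 hZ] with p h1 h2
    exact (hC p ⟨h1, h2⟩).symm
  have hsol : ∀ π, (π ∈ BarCouplings (fun _ => y) σX σZ ∧
      ∀ π' ∈ BarCouplings (fun _ => y) σX σZ, ∫ p, c p.1 p.2 ∂π ≤ ∫ p, c p.1 p.2 ∂π') ↔
      π ∈ BarCouplings (fun _ => y) σX σZ ∧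
      ∀ π' ∈ BarCouplings (fun _ => y) σX σZ, ∫ p, C p ∂π ≤ ∫ p, C p ∂π' := by
    refine fun π => and_congr_right fun hπ => forall₂_congr fun π' hπ' => ?_
    rw [hcost π hπ, hcost π' hπ']
  simp only [hsol]
  have hgraphs : ∀ π, (π ∈ BarCouplings (fun _ => y) σX σZ ∧
      ∀ π' ∈ BarCouplings (fun _ => y) σX σZ, ∫ p, C p ∂π ≤ ∫ p, C p ∂π') →
      ∃ Tm Tp : ℝ → ℝ, (∀ x, Tm x ∈ Icc z₁ z₂) ∧ (∀ x, Tp x ∈ Icc z₃ z₄) ∧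
        Antitone Tm ∧ Monotone Tp ∧ ∀ᵐ p ∂π, p.2 = Tm p.1 ∨ p.2 = Tp p.1 := by
    rintro π ⟨hπ, hmin⟩
    obtain ⟨hcoup, κ, hκ, hbar⟩ := id hπ
    exact exists_monotone_graphs hZ hz₂ hz₃ hcoup hκ hbar
      (ae_not_swap (σX := σX) (σZ := σZ) hR hX hZ hSM hC hπ hmin hκ)
  refine ⟨?_, fun π hπ => ?_⟩
  · obtain ⟨π, hπ, hmin⟩ := exists_isMinOn_barCouplings (σX := σX) hR hy C
    refine ⟨π, ⟨hπ, hmin⟩, fun π' ⟨hπ', hmin'⟩ => ?_⟩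
    have := Couplings.isProbabilityMeasure hπ.1
    have := Couplings.isProbabilityMeasure hπ'.1
    -- The cost is linear, so the average is again optimal and lives on two graphs. A null set of
    -- the average is null for `π` and for `π'`, so the same graphs carry both and fix their
    -- conditionals.
    have hav := average_mem_barCouplings hR hπ hπ'
    obtain ⟨Tm, Tp, hTm, hTp, -, -, hT⟩ := hgraphs _ ⟨hav, fun ρ hρ => by
      have h1 := hmin ρ hρ
      have h2 := hmin' ρ hρ
      rw [integral_smul_nnreal_measure, integral_add_measure (C.integrable _) (C.integrable _),
        NNReal.smul_def, smul_eq_mul, NNReal.coe_inv, NNReal.coe_ofNat]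
      linarith⟩
    have hTadd : ∀ᵐ p ∂(π + π'), p.2 = Tm p.1 ∨ p.2 = Tp p.1 :=
      (Measure.ae_smul_measure_iff (by norm_num : (2⁻¹ : ℝ≥0) ≠ 0)).1 hT
    rw [ae_add_measure_iff] at hTadd
    obtain ⟨-, κ, hκ, hbar⟩ := hπ
    obtain ⟨-, κ', hκ', hbar'⟩ := hπ'
    have e := ae_eq_two_diracs hκ hbar (fun x => (hTm x).2.trans_lt hz₂)
      (fun x => hz₃.trans_le (hTp x).1) hTadd.1
    have e' := ae_eq_two_diracs hκ' hbar' (fun x => (hTm x).2.trans_lt hz₂)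
      (fun x => hz₃.trans_le (hTp x).1) hTadd.2
    rw [hκ.eq_compProd, hκ'.eq_compProd]
    have := hκ.isMarkov
    have := hκ'.isMarkov
    refine Measure.compProd_congr ?_
    filter_upwards [e, e'] with x h h'
    rw [h, h']
  · obtain ⟨Tm, Tp, hTm, hTp, hanti, hmono, hT⟩ := hgraphs π hπ
    refine ⟨Tm, Tp, fun x _ => hTm x, fun x _ => hTp x, hanti.antitoneOn _, hmono.monotoneOn _,
      hT, fun κ hκ => ?_⟩
    obtain ⟨⟨-, κ', hκ', hbar⟩, -⟩ := hπ
    filter_upwards [hκ.ae_eq hκ', ae_eq_two_diracs hκ' hbar (fun x => (hTm x).2.trans_lt hz₂)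
      (fun x => hz₃.trans_le (hTp x).1) hT] with x hx hx'
    have hm := (hTm x).2.trans_lt hz₂
    have hp := hz₃.trans_le (hTp x).1
    have hpos : 0 < Tp x - Tm x := by linarith
    refine ⟨_, _, Real.toNNReal_pos.2 (div_pos (by linarith) hpos),
      Real.toNNReal_pos.2 (div_pos (by linarith) hpos), ?_, hx.trans hx'⟩
    rw [← Real.toNNReal_add (div_nonneg (by linarith) hpos.le)
      (div_nonneg (by linarith) hpos.le), ← add_div, sub_add_sub_cancel, div_self hpos.ne',
      Real.toNNReal_one]
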